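/- A hypergraph is a pair $H=(V,E)$ where $V$ is a non-empty finite set and $E$ is a finite multiset of subsets of $V$ (the edges; repeated edges count as distinct). For an integer $k\ge 3$, a 2-covering $k$-hypergraph is a hypergraph in which every edge has exactly $k$ vertices and every pair of distinct vertices lies together in at least one edge. A closed trail in $H$ is a sequence $v_0e_1v_1e_2\ldots e_sv_s$ with $s\ge 2$, $v_0=v_s$, all $v_i\in V$, the $e_i\in E$ pairwise distinct edges, and $v_{i-1},v_i\in e_i$ with $v_{i-1}\ne v_i$ for $i=1,\ldots,s$; the vertices $v_0,\ldots,v_s$ are its anchors. An Euler family of $H$ is a collection of closed trails, pairwise sharing no anchors and no edges, that jointly traverse every edge of $H$. $H$ is quasi-eulerian if it has no edges or admits an Euler family. Theorem. Let $k\ge 4$, and let $H$ be a 2-covering $k$-hypergraph with at least two edges. Then $H$ is quasi-eulerian. -/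

import Mathlib

/-- A hypergraph with vertex set `V` whose multiset of edges is indexed by `E`:
`H.edge e` is the (finite) set of vertices of the edge `e`. As `edge` need not be injective, repeated edges
are allowed, and they count as distinct edges. -/
structure MultiHypergraph (V E : Type*) where
  /-- the set of vertices incident with an edge -/
  edge : E → Finset V

namespace MultiHypergraph

/-- Every edge has cardinality `k`. -/
def IsUniform {V E : Type*} (H : MultiHypergraph V E) (k : ℕ) : Prop :=
  ∀ e : E, (H.edge e).card = k

/-- `H` is an `l`-covering `k`-hypergraph, where `2 ≤ l < k`: it is `k`-uniform, and every
`l`-subset of vertices lies in at least one edge. -/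
structure IsCovering {V E : Type*} (H : MultiHypergraph V E) (l k : ℕ) : Prop where
  two_le : 2 ≤ l
  lt : l < k
  uniform : H.IsUniform k
  covers : ∀ S : Finset V, S.card = l → ∃ e : E, S ⊆ H.edge e

/-- Walks `v₀ e₁ v₁ e₂ … eₙ vₙ`: consecutive anchors are distinct and both lie in the edge
between them. -/
inductive Walk {V E : Type*} (H : MultiHypergraph V E) : V → V → Type _
  | nil (v : V) : Walk H v v
  | cons {u v w : V} (e : E) (hu : u ∈ H.edge e) (hv : v ∈ H.edge e) (huv : u ≠ v)
      (p : Walk H v w) : Walk H u w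

namespace Walk

/-- The sequence `e₁, …, eₙ` of edges of a walk. -/
def edges {V E : Type*} {H : MultiHypergraph V E} : {u v : V} → H.Walk u v → List E
  | _, _, nil _ => []
  | _, _, cons e _ _ _ p => e :: p.edges

/-- The sequence `v₀, …, vₙ` of anchors of a walk. -/
def anchors {V E : Type*} {H : MultiHypergraph V E} : {u v : V} → H.Walk u v → List V
  | _, _, nil v => [v]
  | u, _, cons _ _ _ _ p => u :: p.anchors

/-- The length `n` of a walk `v₀ e₁ v₁ … eₙ vₙ`. -/
def length {V E : Type*} {H : MultiHypergraph V E} {u v : V} (p : H.Walk u v) : ℕ :=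
  p.edges.length

/-- A trail is a walk whose edges are pairwise distinct. -/
def IsTrail {V E : Type*} {H : MultiHypergraph V E} {u v : V} (p : H.Walk u v) : Prop :=
  p.edges.Nodup

end Walk

/-- A closed trail: a trail from a vertex to itself, of length at least 2. -/
structure ClosedTrail {V E : Type*} (H : MultiHypergraph V E) where
  /-- the first and last anchor -/
  base : V
  /-- the underlying walk -/
  walk : H.Walk base base
  isTrail : walk.IsTrail
  two_le_length : 2 ≤ walk.length

/-- An Euler family: a collection of pairwise anchor-disjoint and edge-disjoint closed trails that
jointly traverse every edge. -/
structure IsEulerFamily {V E : Type*} (H : MultiHypergraph V E) (F : Set H.ClosedTrail) :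
    Prop where
  anchor_disjoint : F.Pairwise fun S T => S.walk.anchors.Disjoint T.walk.anchors
  edge_disjoint : F.Pairwise fun S T => S.walk.edges.Disjoint T.walk.edges
  traverses : ∀ e : E, ∃ T ∈ F, e ∈ T.walk.edges

/-- A hypergraph is quasi-eulerian if it has no edges or admits an Euler family. -/
def IsQuasiEulerian {V E : Type*} (H : MultiHypergraph V E) : Prop :=
  IsEmpty E ∨ ∃ F : Set H.ClosedTrail, H.IsEulerFamily F

end MultiHypergraph

/-! It suffices to choose two vertices in every edge so that the resulting multigraph has all
degrees even. Such a graph splits into closed trails with disjoint anchors, and these remain closed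
trails when the edges are enlarged again (`IsQuasiEulerian.mono`).

The choice is encoded as a perfect matching of `gadget`. It has a clique on the incidences at each
vertex and `m = k - 2` dummies for each edge, joined to the incidences of that edge. The dummies
absorb all but two incidences of the edge, and the remaining incidences are paired off within the
cliques (`exists_even_subgraph_of_perfect`).

If there is no perfect matching, Tutte's theorem and a parity argument give a barrier `U` of minimum
size with surplus at least two, so every vertex of `U` touches at least three odd sets. Hence `U`
consists of whole blocks: all incidences of each of `s` edges and all dummies of each of `t` other
edges. Setting aside the isolated dummies of the `s` edges, at least `2 * s + m * t + 2` odd sets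
remain. By the covering property, any two of these are joined by a removed edge. Counting incidences
in two ways (`counting_bounds`) leaves only `s = 0`, `t = 1` and exactly `k` sets. A second edge
then gives a contradiction (`false_of_two_le_card`). -/

namespace MultiHypergraph

variable {V E : Type*}

/-! ### Walks: concatenation, cutting, enlarging edges -/

namespace Walk

variable {H : MultiHypergraph V E}

/-- Concatenation of walks. -/
def append : {u v w : V} → H.Walk u v → H.Walk v w → H.Walk u w
  | _, _, _, nil _, q => q
  | _, _, _, cons e hu hv huv p, q => cons e hu hv huv (p.append q)

theorem edges_append {u v w : V} (p : H.Walk u v) (q : H.Walk v w) :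
    (p.append q).edges = p.edges ++ q.edges := by
  induction p with
  | nil v => rfl
  | cons e hu hv huv p ih => simp [append, edges, ih]

/-- A walk can be cut at any of its anchors. -/
theorem exists_eq_append {u v w : V} (p : H.Walk u w) (hv : v ∈ p.anchors) :
    ∃ (q : H.Walk u v) (r : H.Walk v w), p = q.append r := by
  induction p with
  | nil x =>
    obtain rfl : v = x := by simpa [anchors] using hv
    exact ⟨nil v, nil v, rfl⟩
  | @cons x y z e hx hy hxy p ih =>
    by_cases hvx : v = x
    · subst hvx
      exact ⟨nil v, cons e hx hy hxy p, rfl⟩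
    · obtain ⟨q, r, rfl⟩ := ih (by simpa [anchors, hvx] using hv)
      exact ⟨cons e hx hy hxy q, r, rfl⟩

theorem start_mem_anchors {u v : V} (p : H.Walk u v) : u ∈ p.anchors := by
  cases p <;> simp [anchors]

/-- Every anchor of a walk with at least one edge lies in a traversed edge. -/
theorem exists_mem_edge_of_mem_anchors {u v x : V} (p : H.Walk u v) (hp : p.edges ≠ [])
    (hx : x ∈ p.anchors) : ∃ e ∈ p.edges, x ∈ H.edge e := by
  induction p with
  | nil v => simp [edges] at hp
  | @cons y z w e hy hz hyz p ih =>
    rcases List.mem_cons.1 (show x ∈ y :: p.anchors from hx) with rfl | hx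
    · exact ⟨e, by simp [edges], hy⟩
    · by_cases hp' : p.edges = []
      · cases p with
        | nil =>
          obtain rfl : x = z := by simpa [anchors] using hx
          exact ⟨e, by simp [edges], hz⟩
        | cons => simp [edges] at hp'
      · obtain ⟨f, hf, hxf⟩ := ih hp' hx
        exact ⟨f, by simp [edges, hf], hxf⟩

/-- A walk of `H` seen in a hypergraph with larger edges. -/
def mapLe {K : MultiHypergraph V E} (h : ∀ e, H.edge e ⊆ K.edge e) :
    {u v : V} → H.Walk u v → K.Walk u v
  | _, _, nil v => nil v
  | _, _, cons e hu hv huv p => cons e (h e hu) (h e hv) huv (p.mapLe h)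

theorem edges_mapLe {K : MultiHypergraph V E} (h : ∀ e, H.edge e ⊆ K.edge e) {u v : V}
    (p : H.Walk u v) : (p.mapLe h).edges = p.edges := by
  induction p with
  | nil v => rfl
  | cons e hu hv huv p ih => simp [mapLe, edges, ih]

theorem anchors_mapLe {K : MultiHypergraph V E} (h : ∀ e, H.edge e ⊆ K.edge e) {u v : V}
    (p : H.Walk u v) : (p.mapLe h).anchors = p.anchors := by
  induction p with
  | nil v => rfl
  | cons e hu hv huv p ih => simp [mapLe, anchors, ih]

theorem two_le_length_of_edges_ne_nil {u : V} (p : H.Walk u u) (hp : p.edges ≠ []) :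
    2 ≤ p.length := by
  cases p with
  | nil => simp [edges] at hp
  | cons e hu hv huv p =>
    cases p with
    | nil => exact absurd rfl huv
    | cons => simp [length, edges]

end Walk

/-- An Euler family remains one when the edges are enlarged. -/
theorem IsQuasiEulerian.mono {H K : MultiHypergraph V E} (h : ∀ e, H.edge e ⊆ K.edge e)
    (hH : H.IsQuasiEulerian) : K.IsQuasiEulerian := by
  rcases hH with hE | ⟨F, hF⟩
  · exact Or.inl hE
  let φ : H.ClosedTrail → K.ClosedTrail := fun T =>
    { base := T.base
      walk := T.walk.mapLe h
      isTrail := by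
        have := T.isTrail
        rwa [Walk.IsTrail, ← Walk.edges_mapLe h] at this
      two_le_length := by
        have := T.two_le_length
        rwa [Walk.length, ← Walk.edges_mapLe h] at this }
  refine Or.inr ⟨φ '' F, ?_, ?_, ?_⟩
  · rintro _ ⟨S, hS, rfl⟩ _ ⟨T, hT, rfl⟩ hST
    simpa [φ, Walk.anchors_mapLe] using hF.anchor_disjoint hS hT (fun h => hST (by rw [h]))
  · rintro _ ⟨S, hS, rfl⟩ _ ⟨T, hT, rfl⟩ hST
    simpa [φ, Walk.edges_mapLe] using hF.edge_disjoint hS hT (fun h => hST (by rw [h]))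
  · intro e
    obtain ⟨T, hT, he⟩ := hF.traverses e
    exact ⟨φ T, ⟨T, hT, rfl⟩, by simpa [φ, Walk.edges_mapLe] using he⟩

/-! ### Even graphs decompose into anchor-disjoint closed trails -/

open Classical in
/-- The number of edges from `A` that contain `v`. -/
noncomputable def degreeIn (H : MultiHypergraph V E) (A : Finset E) (v : V) : ℕ :=
  (A.filter fun e => v ∈ H.edge e).card

open Classical in
theorem odd_degreeIn_erase {H : MultiHypergraph V E} {A : Finset E} {e : E} (he : e ∈ A) (x : V) :
    Odd (H.degreeIn (A.erase e) x) ↔ Xor (Odd (H.degreeIn A x)) (x ∈ H.edge e) := by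
  have key : H.degreeIn A x = H.degreeIn (A.erase e) x + if x ∈ H.edge e then 1 else 0 := by
    unfold degreeIn
    rw [Finset.filter_erase]
    split_ifs with hx
    · rw [Finset.card_erase_add_one]
      simp [he, hx]
    · rw [Finset.erase_eq_of_notMem (by simp [hx]), add_zero]
  rw [key]
  split_ifs with hx <;> simp [hx, xor_def, Nat.odd_add_one]

theorem exists_edge_of_odd_degreeIn {H : MultiHypergraph V E} {A : Finset E} {u : V}
    (h : Odd (H.degreeIn A u)) : ∃ e ∈ A, u ∈ H.edge e := by
  classical
  have : 0 < H.degreeIn A u := h.pos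
  obtain ⟨e, he⟩ := Finset.card_pos.1 this
  exact ⟨e, by simpa using he⟩

theorem exists_edge_eq_pair {H : MultiHypergraph V E} (hH : H.IsUniform 2) {e : E} {u : V}
    (hu : u ∈ H.edge e) : ∃ v, u ≠ v ∧ ∀ x, x ∈ H.edge e ↔ x = u ∨ x = v := by
  classical
  obtain ⟨a, b, hab, h⟩ := Finset.card_eq_two.1 (hH e)
  rw [h, Finset.mem_insert, Finset.mem_singleton] at hu
  rcases hu with rfl | rfl
  · exact ⟨b, hab, by simp [h]⟩
  · exact ⟨a, hab.symm, by simp [h, or_comm]⟩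

/-- In a graph, two vertices that are the only ones of odd degree are joined by a trail. -/
theorem exists_trail_of_odd_degreeIn {H : MultiHypergraph V E} (hH : H.IsUniform 2)
    (A : Finset E) {u w : V} (huw : u ≠ w) (hA : ∀ x, Odd (H.degreeIn A x) ↔ x = u ∨ x = w) :
    ∃ p : H.Walk u w, p.IsTrail ∧ ∀ e ∈ p.edges, e ∈ A := by
  classical
  induction A using Finset.strongInduction generalizing u with
  | H A ih =>
    obtain ⟨e, heA, hue⟩ := exists_edge_of_odd_degreeIn ((hA u).2 (Or.inl rfl))
    obtain ⟨v, huv, he⟩ := exists_edge_eq_pair hH hue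
    have hve : v ∈ H.edge e := (he v).2 (Or.inr rfl)
    by_cases hvw : v = w
    · subst hvw
      exact ⟨.cons e hue hve huv (.nil v), by simp [Walk.IsTrail, Walk.edges],
        by simpa [Walk.edges] using heA⟩
    -- Deleting the edge `e` between `u` and `v` moves the odd degree from `u` to `v`.
    · obtain ⟨p, hp, hpA⟩ := ih _ (Finset.erase_ssubset heA) hvw (fun x => by
        rw [odd_degreeIn_erase heA, hA, he, Xor]
        grind)
      refine ⟨.cons e hue hve huv p, ?_, ?_⟩
      · refine List.nodup_cons.2 ⟨fun h => ?_, hp⟩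
        simpa using hpA e h
      · intro f hf
        rcases List.mem_cons.1 (show f ∈ e :: p.edges from hf) with rfl | hf
        · exact heA
        · exact Finset.mem_of_mem_erase (hpA f hf)

/-- In an even graph, every edge at `u` lies on a closed trail based at `u`. -/
theorem exists_closed_trail_of_even {H : MultiHypergraph V E} (hH : H.IsUniform 2)
    {A : Finset E} (hA : ∀ x, Even (H.degreeIn A x)) {e : E} (he : e ∈ A) {u : V}
    (hu : u ∈ H.edge e) :
    ∃ p : H.Walk u u, p.IsTrail ∧ (∀ f ∈ p.edges, f ∈ A) ∧ p.edges ≠ [] := by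
  classical
  obtain ⟨v, huv, hev⟩ := exists_edge_eq_pair hH hu
  -- Without `e`, exactly the two ends of `e` have odd degree, so a trail leads back from `v` to
  -- `u`.
  obtain ⟨p, hp, hpA⟩ := exists_trail_of_odd_degreeIn hH (A.erase e) huv.symm (fun x => by
    rw [odd_degreeIn_erase he, hev, Xor, ← Nat.not_even_iff_odd]
    simp [hA x, or_comm])
  refine ⟨.cons e hu ((hev v).2 (Or.inr rfl)) huv p, ?_, ?_, by simp [Walk.edges]⟩
  · refine List.nodup_cons.2 ⟨fun h => ?_, hp⟩
    simpa using hpA e h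
  · intro f hf
    rcases List.mem_cons.1 (show f ∈ e :: p.edges from hf) with rfl | hf
    · exact he
    · exact Finset.mem_of_mem_erase (hpA f hf)

open Classical in
/-- In a graph, removing a trail changes the parity of the degree only at its two ends. -/
theorem odd_degreeIn_sdiff {H : MultiHypergraph V E} (hH : H.IsUniform 2)
    {A : Finset E} {u w : V} (p : H.Walk u w) (hp : p.IsTrail) (hpA : ∀ f ∈ p.edges, f ∈ A)
    (x : V) : Odd (H.degreeIn (A \ p.edges.toFinset) x) ↔
      Xor (Odd (H.degreeIn A x)) (Xor (x = u) (x = w)) := by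
  induction p generalizing A with
  | nil v => simp [Walk.edges, xor_def]
  | @cons y z w e hy hz hyz p ih =>
    have hp' : e ∉ p.edges ∧ p.edges.Nodup := List.nodup_cons.1 hp
    have heA : e ∈ A := hpA e (by simp [Walk.edges])
    obtain ⟨z', hyz', hez⟩ := exists_edge_eq_pair hH hy
    obtain rfl : z = z' := ((hez z).1 hz).resolve_left hyz.symm
    have h1 : A \ (Walk.cons e hy hz hyz p).edges.toFinset = A.erase e \ p.edges.toFinset := by
      ext f
      simp [Walk.edges]
      tauto
    rw [h1, ih hp'.2, odd_degreeIn_erase heA, hez]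
    · unfold Xor
      grind
    · intro f hf
      exact Finset.mem_erase.2 ⟨fun h => hp'.1 (h ▸ hf), hpA f (by simp [Walk.edges, hf])⟩

/-- In an even graph, every edge at `u` extends to a closed trail based at `u` that uses all
edges at its anchors. -/
theorem exists_saturated_closed_trail {H : MultiHypergraph V E} (hH : H.IsUniform 2)
    {A : Finset E} (hA : ∀ x, Even (H.degreeIn A x)) {e : E} (he : e ∈ A) {u : V}
    (hu : u ∈ H.edge e) :
    ∃ p : H.Walk u u, p.IsTrail ∧ (∀ f ∈ p.edges, f ∈ A) ∧ p.edges ≠ [] ∧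
      ∀ f ∈ A, ∀ x ∈ p.anchors, x ∈ H.edge f → f ∈ p.edges := by
  classical
  -- A longest closed trail at `u` works: an unused edge at an anchor `x` lies in the graph left
  -- over, which is again even, so a closed trail at `x` could be spliced in.
  let Q : ℕ → Prop := fun n =>
    ∃ p : H.Walk u u, p.IsTrail ∧ (∀ f ∈ p.edges, f ∈ A) ∧ p.edges ≠ [] ∧ p.edges.length = n
  have hQ : ∀ n, Q n → n ≤ A.card := by
    rintro _ ⟨p, hp, hpA, -, rfl⟩
    rw [← List.toFinset_card_of_nodup hp]
    exact Finset.card_le_card fun f hf => hpA f (by simpa using hf)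
  obtain ⟨p₀, h₀, h₁, h₂⟩ := exists_closed_trail_of_even hH hA he hu
  obtain ⟨p, hp, hpA, hpn, hlen⟩ :=
    Nat.findGreatest_spec (P := Q) (hQ _ ⟨p₀, h₀, h₁, h₂, rfl⟩) ⟨p₀, h₀, h₁, h₂, rfl⟩
  refine ⟨p, hp, hpA, hpn, fun f hf x hx hxf => ?_⟩
  by_contra hfp
  obtain ⟨c, hc, hcA, hcn⟩ := exists_closed_trail_of_even hH (A := A \ p.edges.toFinset)
    (fun y => by
      rw [← Nat.not_odd_iff_even, odd_degreeIn_sdiff hH p hp hpA, ← Nat.not_even_iff_odd]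
      simp [hA y, Xor]) (e := f) (by simp [hf, hfp]) hxf
  obtain ⟨q, r, rfl⟩ := p.exists_eq_append hx
  have hmax : Q ((q.append (c.append r)).edges.length) := by
    refine ⟨q.append (c.append r), ?_, ?_, ?_, rfl⟩
    · simp only [Walk.IsTrail, Walk.edges_append] at hp ⊢
      simp only [Walk.edges_append, List.toFinset_append, Finset.mem_sdiff, Finset.mem_union,
        List.mem_toFinset] at hcA
      rw [Walk.IsTrail] at hc
      simp only [List.nodup_append, List.mem_append] at hp ⊢
      grind
    · simp only [Walk.edges_append, List.mem_append] at hpA ⊢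
      rintro g (hg | hg | hg)
      · exact hpA g (Or.inl hg)
      · exact (Finset.mem_sdiff.1 (hcA g hg)).1
      · exact hpA g (Or.inr hg)
    · simp [Walk.edges_append, hcn]
  have h3 := Nat.le_findGreatest (hQ _ hmax) hmax
  rw [← hlen] at h3
  have h4 := List.length_pos_iff.2 hcn
  simp only [Walk.edges_append, List.length_append] at h3
  omega

/-- An even graph decomposes into anchor-disjoint closed trails. -/
theorem exists_family_of_even {H : MultiHypergraph V E} (hH : H.IsUniform 2)
    (A : Finset E) (hA : ∀ x, Even (H.degreeIn A x)) :
    ∃ F : Set H.ClosedTrail, (F.Pairwise fun S T => S.walk.anchors.Disjoint T.walk.anchors) ∧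
      (F.Pairwise fun S T => S.walk.edges.Disjoint T.walk.edges) ∧
      (∀ e ∈ A, ∃ T ∈ F, e ∈ T.walk.edges) ∧ ∀ T ∈ F, ∀ e ∈ T.walk.edges, e ∈ A := by
  classical
  induction A using Finset.strongInduction with
  | H A ih =>
    rcases A.eq_empty_or_nonempty with rfl | ⟨e, he⟩
    · exact ⟨∅, by simp⟩
    obtain ⟨u, hu⟩ : (H.edge e).Nonempty := Finset.card_pos.1 (by rw [hH e]; norm_num)
    obtain ⟨p, hp, hpA, hpn, hsat⟩ := exists_saturated_closed_trail hH hA he hu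
    have hep : e ∈ p.edges := hsat e he u p.start_mem_anchors hu
    have hss : A \ p.edges.toFinset ⊂ A :=
      Finset.ssubset_iff_subset_ne.2 ⟨Finset.sdiff_subset, fun h => by
        have := h ▸ he
        simp [hep] at this⟩
    obtain ⟨F, hF1, hF2, hF3, hF4⟩ := ih _ hss (fun y => by
      rw [← Nat.not_odd_iff_even, odd_degreeIn_sdiff hH p hp hpA, ← Nat.not_even_iff_odd]
      simp [hA y, Xor])
    let T₀ : H.ClosedTrail := ⟨u, p, hp, p.two_le_length_of_edges_ne_nil hpn⟩
    -- A common anchor would lie in an edge left over for `T`, but `p` has used all edges of `A` at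
    -- its anchors.
    have hdisj : ∀ T ∈ F, T₀.walk.anchors.Disjoint T.walk.anchors := by
      intro T hT x hx hxT
      have hne : T.walk.edges ≠ [] := by
        have := T.two_le_length
        intro h
        simp [Walk.length, h] at this
      obtain ⟨f, hf, hxf⟩ := T.walk.exists_mem_edge_of_mem_anchors hne hxT
      have hfA := Finset.mem_sdiff.1 (hF4 T hT f hf)
      exact hfA.2 (List.mem_toFinset.2 (hsat f hfA.1 x hx hxf))
    have hdisj' : ∀ T ∈ F, T₀.walk.edges.Disjoint T.walk.edges := by
      intro T hT f hf hfT
      exact (Finset.mem_sdiff.1 (hF4 T hT f hfT)).2 (List.mem_toFinset.2 hf)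
    refine ⟨insert T₀ F, ?_, ?_, ?_, ?_⟩
    · exact hF1.insert fun T hT _ => ⟨hdisj T hT, (hdisj T hT).symm⟩
    · exact hF2.insert fun T hT _ => ⟨hdisj' T hT, (hdisj' T hT).symm⟩
    · intro f hf
      by_cases hfp : f ∈ p.edges
      · exact ⟨T₀, Set.mem_insert _ _, hfp⟩
      · obtain ⟨T, hT, hfT⟩ := hF3 f (by simp [hf, hfp])
        exact ⟨T, Set.mem_insert_of_mem _ hT, hfT⟩
    · rintro T (rfl | hT) f hf
      · exact hpA f hf
      · exact (Finset.mem_sdiff.1 (hF4 T hT f hf)).1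

/-- A graph in which all degrees are even is quasi-eulerian. -/
theorem isQuasiEulerian_of_even [Fintype E] {H : MultiHypergraph V E} (hH : H.IsUniform 2)
    (hA : ∀ x, Even (H.degreeIn Finset.univ x)) : H.IsQuasiEulerian := by
  obtain ⟨F, h1, h2, h3, -⟩ := exists_family_of_even hH Finset.univ hA
  exact Or.inr ⟨F, h1, h2, fun e => h3 e (Finset.mem_univ e)⟩

end MultiHypergraph

/-! ### Barriers from Tutte's theorem -/

namespace SimpleGraph

/-- A set `U` of vertices together with disjoint odd sets of vertices whose outer neighbours all
lie in `U`. -/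
structure IsBarrier {N : Type*} (G : SimpleGraph N) (U : Finset N) (𝒞 : Finset (Finset N)) :
    Prop where
  odd : ∀ C ∈ 𝒞, Odd C.card
  notMem : ∀ C ∈ 𝒞, ∀ x ∈ C, x ∉ U
  closed : ∀ C ∈ 𝒞, ∀ x ∈ C, ∀ y, G.Adj x y → y ∉ U → y ∈ C
  eq_of_mem : ∀ C ∈ 𝒞, ∀ D ∈ 𝒞, ∀ x, x ∈ C → x ∈ D → C = D

variable {N : Type*} [Fintype N] {G : SimpleGraph N}

/-- One direction of Tutte's theorem in terms of barriers. -/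
theorem exists_isBarrier_of_not_perfect (h : ¬ ∃ M : G.Subgraph, M.IsPerfectMatching) :
    ∃ (U : Finset N) (𝒞 : Finset (Finset N)), G.IsBarrier U 𝒞 ∧ U.card < 𝒞.card := by
  classical
  rw [tutte] at h
  push Not at h
  obtain ⟨u, hu⟩ := h
  set K := ((⊤ : G.Subgraph).deleteVerts u).coe with hK
  let f : K.ConnectedComponent → Finset N := fun c => c.supp.toFinset.map (.subtype _)
  have hmem : ∀ c x, x ∈ f c ↔ ∃ h, (⟨x, h⟩ : ((⊤ : G.Subgraph).deleteVerts u).verts) ∈ c.supp := by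
    intro c x
    simp [f]
  have hf : Function.Injective f := by
    intro c d hcd
    obtain ⟨x, hx⟩ := c.nonempty_supp
    have h1 : (x : N) ∈ f c := (hmem _ _).2 ⟨x.2, hx⟩
    rw [hcd, hmem] at h1
    exact ConnectedComponent.eq_of_common_vertex hx h1.2
  refine ⟨u.toFinset, K.oddComponents.toFinset.image f, ⟨?_, ?_, ?_, ?_⟩, ?_⟩
  · simp only [Finset.mem_image, Set.mem_toFinset]
    rintro _ ⟨c, hc, rfl⟩
    simpa [f, Set.ncard_eq_toFinset_card'] using hc
  · simp only [Finset.mem_image, Set.mem_toFinset]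
    rintro _ ⟨c, hc, rfl⟩ x hx
    obtain ⟨h, -⟩ := (hmem _ _).1 hx
    simpa using h
  · simp only [Finset.mem_image, Set.mem_toFinset]
    rintro _ ⟨c, hc, rfl⟩ x hx y hxy hy
    obtain ⟨h, hx⟩ := (hmem _ _).1 hx
    refine (hmem _ _).2 ⟨by simpa using hy, ?_⟩
    refine ConnectedComponent.mem_supp_of_adj_mem_supp c hx ?_
    have h' : x ∉ u := by simpa using h
    simp [hK, hxy, h', hy]
  · simp only [Finset.mem_image, Set.mem_toFinset]
    rintro _ ⟨c, hc, rfl⟩ _ ⟨d, hd, rfl⟩ x hxc hxd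
    obtain ⟨_, hxc⟩ := (hmem _ _).1 hxc
    obtain ⟨_, hxd⟩ := (hmem _ _).1 hxd
    rw [ConnectedComponent.eq_of_common_vertex hxc hxd]
  · rw [Finset.card_image_of_injective _ hf, ← Set.ncard_eq_toFinset_card',
      ← Set.ncard_eq_toFinset_card']
    exact hu

/-- In a graph of even order, the vertices outside a barrier with a surplus of one form another
odd set. -/
theorem IsBarrier.exists_add_two_le {U : Finset N} {𝒞 : Finset (Finset N)}
    (hU : G.IsBarrier U 𝒞) (hN : Even (Fintype.card N)) (hlt : U.card < 𝒞.card) :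
    ∃ 𝒟, G.IsBarrier U 𝒟 ∧ U.card + 2 ≤ 𝒟.card := by
  classical
  by_cases h2 : U.card + 2 ≤ 𝒞.card
  · exact ⟨𝒞, hU, h2⟩
  -- The sets of a barrier need not be connected, so everything left over can serve as one more set.
  -- If the surplus is exactly one, its size is odd by parity.
  let L : Finset N := Finset.univ.filter fun x => x ∉ U ∧ ∀ C ∈ 𝒞, x ∉ C
  have hL : ∀ x, x ∈ L ↔ x ∉ U ∧ ∀ C ∈ 𝒞, x ∉ C := by simp [L]
  have hcov : (Finset.univ : Finset N) = (U ∪ 𝒞.biUnion id) ∪ L := by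
    ext x
    simp only [Finset.mem_univ, Finset.mem_union, Finset.mem_biUnion, id, hL, true_iff]
    by_cases hx : x ∈ U
    · exact Or.inl (Or.inl hx)
    by_cases hx' : ∃ C ∈ 𝒞, x ∈ C
    · exact Or.inl (Or.inr hx')
    · push Not at hx'
      exact Or.inr ⟨hx, hx'⟩
  have hd1 : Disjoint U (𝒞.biUnion id) := by
    rw [Finset.disjoint_right]
    intro x hx
    obtain ⟨C, hC, hx⟩ := Finset.mem_biUnion.1 hx
    exact hU.notMem C hC x hx
  have hd2 : Disjoint (U ∪ 𝒞.biUnion id) L := by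
    rw [Finset.disjoint_right]
    intro x hx hx'
    rw [hL] at hx
    rcases Finset.mem_union.1 hx' with h | h
    · exact hx.1 h
    · obtain ⟨C, hC, h⟩ := Finset.mem_biUnion.1 h
      exact hx.2 C hC h
  have hcard : Fintype.card N = U.card + ∑ C ∈ 𝒞, C.card + L.card := by
    rw [← Finset.card_univ, hcov, Finset.card_union_of_disjoint hd2,
      Finset.card_union_of_disjoint hd1, Finset.card_biUnion]
    · rfl
    · intro C hC D hD hCD
      rw [Function.onFun, Finset.disjoint_left]
      exact fun x hx hx' => hCD (hU.eq_of_mem C hC D hD x hx hx')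
  have hsum : Even (∑ C ∈ 𝒞, C.card) ↔ Even 𝒞.card := by
    rw [Finset.even_sum_iff_even_card_odd, Finset.filter_true_of_mem hU.odd]
  have hLodd : Odd L.card := by
    have h1 : 𝒞.card = U.card + 1 := by omega
    rw [h1] at hsum
    rw [hcard] at hN
    grind
  refine ⟨insert L 𝒞, ⟨?_, ?_, ?_, ?_⟩, ?_⟩
  · exact Finset.forall_mem_insert _ _ _ |>.2 ⟨hLodd, hU.odd⟩
  · exact Finset.forall_mem_insert _ _ _ |>.2 ⟨fun x hx => ((hL x).1 hx).1, hU.notMem⟩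
  · refine Finset.forall_mem_insert _ _ _ |>.2 ⟨fun x hx y hxy hy => ?_, hU.closed⟩
    rw [hL] at hx ⊢
    exact ⟨hy, fun C hC hyC => hx.2 C hC (hU.closed C hC y hyC x hxy.symm hx.1)⟩
  · intro C hC D hD x hxC hxD
    rcases Finset.mem_insert.1 hC with rfl | hC <;> rcases Finset.mem_insert.1 hD with rfl | hD
    · rfl
    · exact absurd hxD (((hL x).1 hxC).2 D hD)
    · exact absurd hxC (((hL x).1 hxD).2 C hC)
    · exact hU.eq_of_mem C hC D hD x hxC hxD
  · rw [Finset.card_insert_of_notMem]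
    · omega
    · intro h
      obtain ⟨x, hx⟩ := Finset.card_pos.1 hLodd.pos
      exact ((hL x).1 hx).2 L h hx

open Classical in
/-- A graph of even order without perfect matching has a barrier with a surplus of two in which
every removed vertex has neighbours in at least three of the odd sets. -/
theorem exists_minimal_isBarrier (hN : Even (Fintype.card N))
    (h : ¬ ∃ M : G.Subgraph, M.IsPerfectMatching) :
    ∃ (U : Finset N) (𝒞 : Finset (Finset N)), G.IsBarrier U 𝒞 ∧ U.card + 2 ≤ 𝒞.card ∧
      ∀ w ∈ U, 3 ≤ (𝒞.filter fun C => ∃ x ∈ C, G.Adj w x).card := by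
  let Q : ℕ → Prop := fun n =>
    ∃ (U : Finset N) (𝒞 : Finset (Finset N)), G.IsBarrier U 𝒞 ∧ U.card < 𝒞.card ∧ U.card = n
  have hQ : ∃ n, Q n := by
    obtain ⟨U, 𝒞, h1, h2⟩ := exists_isBarrier_of_not_perfect h
    exact ⟨_, U, 𝒞, h1, h2, rfl⟩
  obtain ⟨U, 𝒞₀, h0, hlt, hcard⟩ := Nat.find_spec hQ
  -- Minimality is taken over surplus one, while `𝒞` has surplus two for the same `U`. If `w`
  -- touched at most two sets, dropping `w` and these sets would leave a smaller barrier with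
  -- surplus at least one.
  obtain ⟨𝒞, h𝒞, h2⟩ := h0.exists_add_two_le hN hlt
  refine ⟨U, 𝒞, h𝒞, h2, fun w hw => ?_⟩
  by_contra hlt3
  have hsplit := Finset.card_filter_add_card_filter_not (s := 𝒞) fun C => ∃ x ∈ C, G.Adj w x
  have hUw := Finset.card_erase_add_one hw
  refine Nat.find_min hQ (m := (U.erase w).card) (by omega)
    ⟨U.erase w, 𝒞.filter fun C => ¬ ∃ x ∈ C, G.Adj w x, ⟨?_, ?_, ?_, ?_⟩, by omega, rfl⟩
  · exact fun C hC => h𝒞.odd C (Finset.mem_filter.1 hC).1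
  · exact fun C hC x hx hxU =>
      h𝒞.notMem C (Finset.mem_filter.1 hC).1 x hx (Finset.mem_of_mem_erase hxU)
  · intro C hC x hx y hxy hy
    obtain ⟨hC, hCw⟩ := Finset.mem_filter.1 hC
    refine h𝒞.closed C hC x hx y hxy fun hyU => hy (Finset.mem_erase.2 ⟨?_, hyU⟩)
    rintro rfl
    exact hCw ⟨x, hx, hxy.symm⟩
  · exact fun C hC D hD =>
      h𝒞.eq_of_mem C (Finset.mem_filter.1 hC).1 D (Finset.mem_filter.1 hD).1

/-- A perfect matching as a fixed-point-free involution. -/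
theorem Subgraph.IsPerfectMatching.exists_involution {N : Type*} {G : SimpleGraph N}
    {M : G.Subgraph} (hM : M.IsPerfectMatching) :
    ∃ μ : N → N, (∀ x, μ (μ x) = x) ∧ ∀ x, G.Adj x (μ x) := by
  rw [Subgraph.isPerfectMatching_iff] at hM
  choose μ hμ hμ' using hM
  exact ⟨μ, fun x => (hμ' _ _ (hμ x).symm).symm, fun x => (hμ x).adj_sub⟩

end SimpleGraph

/-! ### The gadget graph: perfect matchings yield even subgraphs -/

namespace MultiHypergraph

variable {V E : Type*}

/-- The incident vertex-edge pairs of a hypergraph. -/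
abbrev Incidence (H : MultiHypergraph V E) : Type _ := {p : V × E // p.1 ∈ H.edge p.2}

/-- The graph on the incidences and on `m` further vertices for each edge: incidences with the same
vertex are adjacent, and the incidences of an edge are adjacent to the further vertices of
that edge. -/
def gadget (H : MultiHypergraph V E) (m : ℕ) : SimpleGraph (H.Incidence ⊕ E × Fin m) where
  Adj
    | .inl i, .inl j => i.1.1 = j.1.1 ∧ i ≠ j
    | .inl i, .inr d => i.1.2 = d.1
    | .inr d, .inl i => i.1.2 = d.1
    | .inr _, .inr _ => False
  symm := ⟨by
    rintro (i | d) (j | d') h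
    · exact ⟨h.1.symm, h.2.symm⟩
    · exact h
    · exact h
    · exact h⟩
  loopless := ⟨by
    rintro (i | d) h
    · exact h.2 rfl
    · exact h⟩

theorem even_card_of_involution {α : Type*} (s : Finset α) (g : ∀ a ∈ s, α)
    (hne : ∀ a ha, g a ha ≠ a) (hmem : ∀ a ha, g a ha ∈ s)
    (hinv : ∀ a ha, g (g a ha) (hmem a ha) = a) : Even s.card := by
  have h : ∑ x ∈ s, (1 : ZMod 2) = 0 :=
    Finset.sum_involution g (fun _ _ => by decide) (fun a ha _ => hne a ha) hmem hinv
  rw [Finset.sum_const, nsmul_one] at h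
  exact (ZMod.natCast_eq_zero_iff_even).1 h

/-- A perfect matching of the gadget graph selects two vertices of every edge such that all
degrees are even. -/
theorem exists_even_subgraph_of_perfect [Fintype E] {H : MultiHypergraph V E} {k : ℕ}
    (hk : 2 ≤ k) (hH : H.IsUniform k) {M : (H.gadget (k - 2)).Subgraph}
    (hM : M.IsPerfectMatching) :
    ∃ K : MultiHypergraph V E, (∀ e, K.edge e ⊆ H.edge e) ∧ K.IsUniform 2 ∧
      ∀ x, Even (K.degreeIn Finset.univ x) := by
  classical
  obtain ⟨μ, hinv, hadj⟩ := hM.exists_involution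
  -- An incidence is selected when its partner is another incidence rather than a dummy.
  let sel : E → V → Prop := fun e v => ∃ h : v ∈ H.edge e, (μ (.inl ⟨(v, e), h⟩)).isLeft
  let K : MultiHypergraph V E := ⟨fun e => (H.edge e).filter (sel e)⟩
  have hKmem : ∀ e v, v ∈ K.edge e ↔ sel e v := by
    intro e v
    simp only [K, Finset.mem_filter]
    exact ⟨fun h => h.2, fun h => ⟨h.1, h⟩⟩
  refine ⟨K, fun e => Finset.filter_subset _ _, fun e => ?_, fun x => ?_⟩
  · have hsplit := Finset.card_filter_add_card_filter_not (s := H.edge e) (sel e)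
    rw [hH e] at hsplit
    have hdummy : ∀ d : Fin (k - 2), ∃ i : H.Incidence, μ (.inr (e, d)) = .inl i ∧ i.1.2 = e := by
      intro d
      have := hadj (.inr (e, d))
      rcases hi : μ (.inr (e, d)) with i | d'
      · rw [hi] at this
        exact ⟨i, rfl, this⟩
      · rw [hi] at this
        exact this.elim
    choose g hg hge using hdummy
    -- Matching is a bijection from the dummies of `e` to its unselected incidences.
    have hcard : ((H.edge e).filter fun v => ¬ sel e v).card = k - 2 := by
      refine Eq.trans (Eq.symm ?_) (Finset.card_fin (k - 2))
      refine Finset.card_bij (fun d _ => (g d).1.1) ?_ ?_ ?_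
      · intro d _
        have hmem : (g d).1.1 ∈ H.edge e := by
          have := (g d).2
          rwa [hge] at this
        refine Finset.mem_filter.2 ⟨hmem, ?_⟩
        rintro ⟨h, hl⟩
        have h1 : (⟨((g d).1.1, e), h⟩ : H.Incidence) = g d :=
          Subtype.ext (Prod.ext rfl (hge d).symm)
        rw [h1, ← hg, hinv] at hl
        simp at hl
      · intro d _ d' _ hdd
        have h1 : g d = g d' := Subtype.ext (Prod.ext hdd ((hge d).trans (hge d').symm))
        have h2 : μ (.inr (e, d)) = μ (.inr (e, d')) := by rw [hg, hg, h1]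
        have h3 := congrArg μ h2
        rw [hinv, hinv] at h3
        simpa using h3
      · intro v hv
        obtain ⟨hv, hns⟩ := Finset.mem_filter.1 hv
        have h1 := hadj (.inl ⟨(v, e), hv⟩)
        rcases hi : μ (.inl ⟨(v, e), hv⟩) with i | ⟨e', d⟩
        · exact absurd ⟨hv, by rw [hi]; rfl⟩ hns
        · rw [hi] at h1
          obtain rfl : e = e' := h1
          refine ⟨d, Finset.mem_univ _, ?_⟩
          have h2 : (Sum.inl (g d) : H.Incidence ⊕ E × Fin (k - 2)) = .inl ⟨(v, e), hv⟩ := by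
            rw [← hg, ← hi, hinv]
          rw [Sum.inl.inj h2]
    rw [hcard] at hsplit
    change (Finset.filter (sel e) (H.edge e)).card = 2
    omega
  -- The matching pairs the selected incidences at `x` among themselves, which is a fixed-point-free
  -- involution on the edges of `K` at `x`.
  · have hpart : ∀ e, sel e x → ∃ (f : E) (he : x ∈ H.edge e) (hf : x ∈ H.edge f),
        μ (.inl ⟨(x, e), he⟩) = .inl ⟨(x, f), hf⟩ ∧ f ≠ e := by
      rintro e ⟨he, hl⟩
      have h1 := hadj (.inl ⟨(x, e), he⟩)
      rcases hi : μ (.inl ⟨(x, e), he⟩) with ⟨⟨y, f⟩, hf⟩ | d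
      · rw [hi] at h1
        obtain rfl : x = y := h1.1
        refine ⟨f, he, hf, hi, ?_⟩
        rintro rfl
        exact h1.2 rfl
      · rw [hi] at hl
        simp at hl
    choose! p hp1 hp2 hp3 hp4 using hpart
    have hmem : ∀ e, sel e x → sel (p e) x := by
      intro e he
      refine ⟨hp2 e he, ?_⟩
      rw [← hp3 e he, hinv]
      rfl
    have hs : ∀ e, e ∈ (Finset.univ.filter fun e => x ∈ K.edge e) ↔ sel e x := by simp [hKmem]
    refine even_card_of_involution _ (fun e _ => p e) (fun e he => hp4 e ((hs e).1 he))
      (fun e he => (hs _).2 (hmem e ((hs e).1 he))) (fun e he => ?_)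
    rw [hs] at he
    have h1 := hp3 (p e) (hmem e he)
    rw [← hp3 e he, hinv] at h1
    simpa using h1.symm

end MultiHypergraph

/-! ### Structure of critical barriers -/

namespace MultiHypergraph

variable {V E : Type*}

section

open scoped Classical

theorem card_filter_incidence [Fintype V] [Fintype E] {H : MultiHypergraph V E} {k : ℕ}
    (hH : H.IsUniform k) (P : E → Prop) :
    (Finset.univ.filter fun i : H.Incidence => P i.1.2).card =
      k * (Finset.univ.filter P).card := by
  rw [Finset.card_eq_sum_card_fiberwise (f := fun i : H.Incidence => i.1.2)
    (t := Finset.univ.filter P) (fun i hi => by simpa using hi), mul_comm]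
  refine Finset.sum_const_nat fun e he => ?_
  rw [← hH e]
  refine Finset.card_bij (fun i _ => i.1.1) ?_ ?_ ?_
  · intro i hi
    obtain rfl : i.1.2 = e := (Finset.mem_filter.1 hi).2
    exact i.2
  · intro i hi j hj hij
    exact Subtype.ext (Prod.ext hij
      ((Finset.mem_filter.1 hi).2.trans (Finset.mem_filter.1 hj).2.symm))
  · intro v hv
    exact ⟨⟨(v, e), hv⟩, by simpa using he, rfl⟩

/-- The edge to which a vertex of the gadget graph belongs. -/
def gadgetEdge {H : MultiHypergraph V E} {m : ℕ} : H.Incidence ⊕ E × Fin m → E :=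
  Sum.elim (fun i => i.1.2) Prod.fst

theorem card_filter_gadgetEdge [Fintype V] [Fintype E] {H : MultiHypergraph V E} {k m : ℕ}
    (hH : H.IsUniform k) (P : E → Prop) :
    (Finset.univ.filter fun x : H.Incidence ⊕ E × Fin m => P (gadgetEdge x)).card =
      (k + m) * (Finset.univ.filter P).card := by
  have h : (Finset.univ.filter fun x : H.Incidence ⊕ E × Fin m => P (gadgetEdge x)) =
      (Finset.univ.filter fun i : H.Incidence => P i.1.2).disjSum
        (Finset.univ.filter P ×ˢ Finset.univ) := by
    ext (i | d) <;> simp only [Finset.mem_filter, Finset.mem_univ, true_and] <;> simp [gadgetEdge]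
  rw [h, Finset.card_disjSum, Finset.card_product, card_filter_incidence hH, Finset.card_fin]
  ring

/-- A barrier of the gadget graph in which every removed vertex has neighbours in at least three of
the odd sets. -/
structure IsCriticalBarrier (H : MultiHypergraph V E) (m : ℕ)
    (U : Finset (H.Incidence ⊕ E × Fin m)) (𝒞 : Finset (Finset (H.Incidence ⊕ E × Fin m))) : Prop
    extends (H.gadget m).IsBarrier U 𝒞 where
  three_le : ∀ w ∈ U, 3 ≤ (𝒞.filter fun C => ∃ x ∈ C, (H.gadget m).Adj w x).card

variable {H : MultiHypergraph V E} {m : ℕ}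

/-- All incidences of the edge lie in `U`. -/
def IncidencesIn (U : Finset (H.Incidence ⊕ E × Fin m)) (e : E) : Prop :=
  ∀ i : H.Incidence, i.1.2 = e → .inl i ∈ U

/-- All further gadget vertices of the edge lie in `U`. -/
def DummiesIn (U : Finset (H.Incidence ⊕ E × Fin m)) (e : E) : Prop :=
  ∀ d : Fin m, .inr (e, d) ∈ U

/-- The set `C` contains an incidence at the vertex `v`. -/
def MeetsAt (C : Finset (H.Incidence ⊕ E × Fin m)) (v : V) : Prop :=
  ∃ i : H.Incidence, i.1.1 = v ∧ .inl i ∈ C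

/-- The set `C` contains no vertex that is isolated by the removal of `U`. -/
def AvoidsIsolated (U C : Finset (H.Incidence ⊕ E × Fin m)) : Prop :=
  ∀ e, IncidencesIn U e → ∀ d, .inr (e, d) ∉ C

/-- The odd sets of a barrier without isolated vertices. -/
noncomputable def mainParts (U : Finset (H.Incidence ⊕ E × Fin m))
    (𝒞 : Finset (Finset (H.Incidence ⊕ E × Fin m))) :
    Finset (Finset (H.Incidence ⊕ E × Fin m)) :=
  𝒞.filter (AvoidsIsolated U)

/-- The number of incidences in `C` with edges whose further gadget vertices lie in `U`. -/
noncomputable def dummyDegree [Fintype V] [Fintype E] (U C : Finset (H.Incidence ⊕ E × Fin m)) :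
    ℕ :=
  (Finset.univ.filter fun i : H.Incidence => .inl i ∈ C ∧ DummiesIn U i.1.2).card

namespace IsCriticalBarrier

variable {U : Finset (H.Incidence ⊕ E × Fin m)} {𝒞 : Finset (Finset (H.Incidence ⊕ E × Fin m))}

/-- The incidences at one vertex form a clique, so those outside `U` cannot be split between two odd
sets. -/
theorem eq_of_vertex_eq (hB : H.IsCriticalBarrier m U 𝒞)
    {C D : Finset (H.Incidence ⊕ E × Fin m)} (hC : C ∈ 𝒞) (hD : D ∈ 𝒞) {i j : H.Incidence}
    (hi : .inl i ∈ C) (hj : .inl j ∈ D) (hij : i.1.1 = j.1.1) : C = D := by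
  by_cases h : i = j
  · subst h
    exact hB.eq_of_mem C hC D hD _ hi hj
  · exact hB.eq_of_mem C hC D hD _ (hB.closed C hC _ hi (.inl j) ⟨hij, h⟩ (hB.notMem D hD _ hj)) hj

theorem eq_of_meetsAt (hB : H.IsCriticalBarrier m U 𝒞)
    {C D : Finset (H.Incidence ⊕ E × Fin m)} (hC : C ∈ 𝒞) (hD : D ∈ 𝒞) {v : V}
    (hi : MeetsAt C v) (hj : MeetsAt D v) : C = D := by
  obtain ⟨i, hi, hiC⟩ := hi
  obtain ⟨j, hj, hjD⟩ := hj
  exact hB.eq_of_vertex_eq hC hD hiC hjD (hi.trans hj.symm)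

/-- Otherwise some incidence `j` of the same edge survives. The odd sets next to `i` then number at
most two: one through the clique at its vertex, and one through the dummies of its edge, which
contains `j`. Criticality demands three. -/
theorem incidencesIn_of_mem (hB : H.IsCriticalBarrier m U 𝒞) {i : H.Incidence}
    (hi : .inl i ∈ U) : IncidencesIn U i.1.2 := by
  intro j hj
  by_contra hjU
  have h3 := hB.three_le _ hi
  have hle : (𝒞.filter fun C => ∃ x ∈ C, (H.gadget m).Adj (.inl i) x).card ≤
      (Finset.univ : Finset Bool).card := by
    refine Finset.card_le_card_of_injOn
      -- The Boolean records through which of the two routes `C` is reached.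
      (fun C => decide (∃ l : H.Incidence, .inl l ∈ C ∧ i.1.1 = l.1.1))
      (fun _ _ => Finset.mem_coe.2 (Finset.mem_univ _)) ?_
    intro C hC D hD hCD
    obtain ⟨hC, x, hx, hix⟩ := Finset.mem_filter.1 hC
    obtain ⟨hD, y, hy, hiy⟩ := Finset.mem_filter.1 hD
    have hdum : ∀ F ∈ 𝒞, ∀ d, .inr d ∈ F → i.1.2 = d.1 → .inl j ∈ F := fun F hF d hd hid =>
      hB.closed F hF _ hd (.inl j) (hj.trans hid) hjU
    by_cases hl : ∃ l : H.Incidence, .inl l ∈ C ∧ i.1.1 = l.1.1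
    · obtain ⟨l', hl', hil'⟩ := of_decide_eq_true (hCD.symm.trans (decide_eq_true hl))
      obtain ⟨l, hl, hil⟩ := hl
      exact hB.eq_of_vertex_eq hC hD hl hl' (hil.symm.trans hil')
    · have hl' := of_decide_eq_false (hCD.symm.trans (decide_eq_false hl))
      rcases x with x | d
      · exact absurd ⟨x, hx, hix.1⟩ hl
      rcases y with y | d'
      · exact absurd ⟨y, hy, hiy.1⟩ hl'
      exact hB.eq_of_mem C hC D hD _ (hdum C hC d hx hix) (hdum D hD d' hy hiy)
  simp only [Finset.card_univ, Fintype.card_bool] at hle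
  omega

/-- All dummies of an edge have the same neighbours, so a surviving dummy would lie in every odd set
next to the removed one, leaving only one such set. -/
theorem dummiesIn_of_mem (hB : H.IsCriticalBarrier m U 𝒞) {e : E} {d : Fin m}
    (hd : .inr (e, d) ∈ U) : DummiesIn U e := by
  intro d'
  by_contra hdU
  have h3 := hB.three_le _ hd
  have hle : (𝒞.filter fun C => ∃ x ∈ C, (H.gadget m).Adj (.inr (e, d)) x).card ≤ 1 := by
    refine Finset.card_le_one.2 fun C hC D hD => ?_
    have key : ∀ F ∈ (𝒞.filter fun C => ∃ x ∈ C, (H.gadget m).Adj (.inr (e, d)) x),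
        .inr (e, d') ∈ F := by
      intro F hF
      obtain ⟨hF, x, hx, hex⟩ := Finset.mem_filter.1 hF
      rcases x with i | d₀
      · exact hB.closed F hF _ hx (.inr (e, d')) hex hdU
      · exact hex.elim
    exact hB.eq_of_mem C (Finset.mem_filter.1 hC).1 D (Finset.mem_filter.1 hD).1 _
      (key C hC) (key D hD)
  omega

/-- With all dummies gone, an incidence sees odd sets only through the clique at its vertex, hence
at most one. -/
theorem not_incidencesIn_of_dummiesIn (hB : H.IsCriticalBarrier m U 𝒞) {e : E}
    (hne : (H.edge e).Nonempty) (hT : DummiesIn U e) : ¬ IncidencesIn U e := by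
  intro hS
  obtain ⟨v, hv⟩ := hne
  have hvU : .inl ⟨(v, e), hv⟩ ∈ U := hS _ rfl
  have h3 := hB.three_le _ hvU
  have hle : (𝒞.filter fun C => ∃ x ∈ C, (H.gadget m).Adj (.inl ⟨(v, e), hv⟩) x).card ≤ 1 := by
    refine Finset.card_le_one.2 fun C hC D hD => ?_
    have key : ∀ F ∈ (𝒞.filter fun C => ∃ x ∈ C, (H.gadget m).Adj (.inl ⟨(v, e), hv⟩) x),
        MeetsAt F v := by
      intro F hF
      obtain ⟨hF, x, hx, hex⟩ := Finset.mem_filter.1 hF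
      rcases x with i | ⟨e', d⟩
      · exact ⟨i, hex.1.symm, hx⟩
      · obtain rfl : e = e' := hex
        exact absurd (hT d) (hB.notMem F hF _ hx)
    exact hB.eq_of_meetsAt (Finset.mem_filter.1 hC).1 (Finset.mem_filter.1 hD).1
      (key C hC) (key D hD)
  omega

/-- An odd set that is not isolated contains either all or none of the gadget vertices of an edge
that is not removed. -/
theorem mem_of_gadgetEdge_eq (hB : H.IsCriticalBarrier m U 𝒞) (hm : 0 < m)
    (hne : ∀ e, (H.edge e).Nonempty) {C : Finset (H.Incidence ⊕ E × Fin m)}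
    (hC : C ∈ mainParts U 𝒞) {x y : H.Incidence ⊕ E × Fin m} (hx : x ∈ C)
    (hT : ¬ DummiesIn U (gadgetEdge x)) (hxy : gadgetEdge y = gadgetEdge x) : y ∈ C := by
  obtain ⟨hC, hC'⟩ := Finset.mem_filter.1 hC
  have hS : ¬ IncidencesIn U (gadgetEdge x) := by
    intro hS
    rcases x with i | d
    · exact hB.notMem C hC _ hx (hS i rfl)
    · exact hC' _ hS _ hx
  have hI : ∀ i : H.Incidence, i.1.2 = gadgetEdge x → .inl i ∉ U := fun i hi hiU =>
    hS (hi ▸ hB.incidencesIn_of_mem hiU)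
  have hD : ∀ d : Fin m, .inr (gadgetEdge x, d) ∉ U := fun d hd => hT (hB.dummiesIn_of_mem hd)
  -- Incidences of an edge are linked only through its dummies, so at least one dummy is needed
  -- here.
  have h1 : ∃ d : Fin m, .inr (gadgetEdge x, d) ∈ C := by
    rcases x with i | ⟨e, d⟩
    · exact ⟨⟨0, hm⟩, hB.closed C hC _ hx _ rfl (hD _)⟩
    · exact ⟨d, hx⟩
  obtain ⟨d, hd⟩ := h1
  have h2 : ∀ i : H.Incidence, i.1.2 = gadgetEdge x → .inl i ∈ C := fun i hi =>
    hB.closed C hC _ hd (.inl i) hi (hI i hi)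
  rcases y with i | ⟨e, d'⟩
  · exact h2 i hxy
  · obtain rfl : e = gadgetEdge x := hxy
    obtain ⟨v, hv⟩ := hne (gadgetEdge x)
    exact hB.closed C hC _ (h2 ⟨(v, _), hv⟩ rfl) _ rfl (hD _)

theorem exists_meetsAt (hB : H.IsCriticalBarrier m U 𝒞) (hm : 0 < m)
    (hne : ∀ e, (H.edge e).Nonempty) {C : Finset (H.Incidence ⊕ E × Fin m)}
    (hC : C ∈ mainParts U 𝒞) : ∃ v, MeetsAt C v := by
  have hC𝒞 := (Finset.mem_filter.1 hC).1
  obtain ⟨x, hx⟩ := Finset.card_pos.1 (hB.odd C hC𝒞).pos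
  rcases x with i | ⟨e, d⟩
  · exact ⟨_, i, rfl, hx⟩
  · obtain ⟨v, hv⟩ := hne e
    exact ⟨v, ⟨(v, e), hv⟩, rfl,
      hB.mem_of_gadgetEdge_eq hm hne hC hx (fun hT => hB.notMem C hC𝒞 _ hx (hT d)) rfl⟩

theorem inl_mem_of_meetsAt (hB : H.IsCriticalBarrier m U 𝒞)
    {C : Finset (H.Incidence ⊕ E × Fin m)} (hC : C ∈ 𝒞) {v : V} (hv : MeetsAt C v) {e : E}
    (hve : v ∈ H.edge e) (hS : ¬ IncidencesIn U e) : .inl ⟨(v, e), hve⟩ ∈ C := by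
  obtain ⟨i, rfl, hi⟩ := hv
  by_cases h : i = ⟨(i.1.1, e), hve⟩
  · rwa [← h]
  · exact hB.closed C hC _ hi _ ⟨rfl, h⟩ fun hU => hS (hB.incidencesIn_of_mem hU)

/-- An edge untouched by `U` keeps its block in one piece, so an odd set spreads from one of its
vertices to all of them. -/
theorem meetsAt_of_mem_edge (hB : H.IsCriticalBarrier m U 𝒞) (hm : 0 < m)
    (hne : ∀ e, (H.edge e).Nonempty) {C : Finset (H.Incidence ⊕ E × Fin m)}
    (hC : C ∈ mainParts U 𝒞) {v w : V} (hv : MeetsAt C v) {e : E} (hve : v ∈ H.edge e)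
    (hwe : w ∈ H.edge e) (hS : ¬ IncidencesIn U e) (hT : ¬ DummiesIn U e) : MeetsAt C w :=
  ⟨⟨(w, e), hwe⟩, rfl, hB.mem_of_gadgetEdge_eq hm hne hC
    (hB.inl_mem_of_meetsAt (Finset.mem_filter.1 hC).1 hv hve hS) hT rfl⟩

/-- Double counting: the representatives `r C` are distinct, so an edge contains at most `m + 2` of
them. -/
theorem sum_card_incidencesIn_le [Fintype E] (hB : H.IsCriticalBarrier m U 𝒞) (hH : H.IsUniform (m + 2))
    {r : Finset (H.Incidence ⊕ E × Fin m) → V} (hr : ∀ C ∈ mainParts U 𝒞, MeetsAt C (r C))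
    {𝒮 : Finset (Finset (H.Incidence ⊕ E × Fin m))} (h𝒮 : 𝒮 ⊆ mainParts U 𝒞) :
    ∑ C ∈ 𝒮, (Finset.univ.filter fun e => IncidencesIn U e ∧ r C ∈ H.edge e).card ≤
      (m + 2) * (Finset.univ.filter fun e => IncidencesIn U e).card := by
  have h := Finset.sum_card_bipartiteAbove_eq_sum_card_bipartiteBelow (s := 𝒮)
    (t := Finset.univ.filter fun e => IncidencesIn U e) fun C e => r C ∈ H.edge e
  simp only [Finset.bipartiteAbove, Finset.bipartiteBelow, Finset.filter_filter] at h
  rw [h, mul_comm, ← smul_eq_mul]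
  refine Finset.sum_le_card_nsmul _ _ _ fun e _ => ?_
  rw [← hH e]
  refine Finset.card_le_card_of_injOn r (fun C hC => (Finset.mem_filter.1 hC).2) ?_
  intro D hD D' hD' hDD
  have hD := h𝒮 (Finset.mem_filter.1 hD).1
  have hD' := h𝒮 (Finset.mem_filter.1 hD').1
  refine hB.eq_of_meetsAt (Finset.mem_filter.1 hD).1 (Finset.mem_filter.1 hD').1 (hr D hD) ?_
  rw [hDD]
  exact hr D' hD'

/-! ### Counting the odd sets -/

variable [Fintype V] [Fintype E]

/-- Edges whose dummies survive contribute to `C` nothing or a full block of even size `2 * m + 2`.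
The rest of the odd set `C` is what `dummyDegree` counts. -/
theorem odd_dummyDegree (hB : H.IsCriticalBarrier m U 𝒞) (hm : 0 < m) (hH : H.IsUniform (m + 2))
    {C : Finset (H.Incidence ⊕ E × Fin m)} (hC : C ∈ mainParts U 𝒞) :
    Odd (dummyDegree U C) := by
  have hne : ∀ e, (H.edge e).Nonempty := fun e => Finset.card_pos.1 (by rw [hH e]; omega)
  have hC𝒞 := (Finset.mem_filter.1 hC).1
  have hodd := hB.odd C hC𝒞
  rw [← Finset.card_filter_add_card_filter_not (s := C) fun x => DummiesIn U (gadgetEdge x)]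
    at hodd
  have h1 : (C.filter fun x => DummiesIn U (gadgetEdge x)).card = dummyDegree U C := by
    symm
    refine Finset.card_bij (fun i _ => .inl i) ?_ ?_ ?_
    · intro i hi
      exact Finset.mem_filter.2 (Finset.mem_filter.1 hi).2
    · intro i _ j _ hij
      exact Sum.inl.inj hij
    · intro x hx
      obtain ⟨hxC, hT⟩ := Finset.mem_filter.1 hx
      rcases x with i | d
      · exact ⟨i, Finset.mem_filter.2 ⟨Finset.mem_univ _, hxC, hT⟩, rfl⟩
      · exact absurd (hT d.2) (hB.notMem C hC𝒞 _ hxC)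
  have h2 : Even (C.filter fun x => ¬ DummiesIn U (gadgetEdge x)).card := by
    rw [Finset.card_eq_sum_card_fiberwise (f := gadgetEdge) (t := Finset.univ) (by simp)]
    refine Finset.even_sum _ fun e _ => ?_
    rcases Finset.eq_empty_or_nonempty
      ((C.filter fun x => ¬ DummiesIn U (gadgetEdge x)).filter fun x => gadgetEdge x = e) with
      h | ⟨x, hx⟩
    · rw [h]
      simp
    · simp only [Finset.mem_filter] at hx
      obtain ⟨⟨hxC, hT⟩, rfl⟩ := hx
      have h3 : ((C.filter fun y => ¬ DummiesIn U (gadgetEdge y)).filter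
          fun y => gadgetEdge y = gadgetEdge x) =
          Finset.univ.filter fun y => gadgetEdge y = gadgetEdge x := by
        ext y
        simp only [Finset.mem_filter, Finset.mem_univ, true_and]
        exact ⟨fun h => h.2, fun h => ⟨⟨hB.mem_of_gadgetEdge_eq hm hne hC hxC hT h, h ▸ hT⟩, h⟩⟩
      rw [h3, card_filter_gadgetEdge hH fun e => e = gadgetEdge x]
      exact Even.mul_right ⟨m + 1, by ring⟩ _
  rw [h1] at hodd
  grind

/-- Lower bound for the number of odd sets that are not isolated. -/
theorem le_card_mainParts (hB : H.IsCriticalBarrier m U 𝒞) (hH : H.IsUniform (m + 2))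
    (hU : U.card + 2 ≤ 𝒞.card) :
    2 * (Finset.univ.filter fun e => IncidencesIn U e).card +
      m * (Finset.univ.filter fun e => DummiesIn U e).card + 2 ≤ (mainParts U 𝒞).card := by
  have h1 : (m + 2) * (Finset.univ.filter fun e => IncidencesIn U e).card +
      m * (Finset.univ.filter fun e => DummiesIn U e).card ≤ U.card := by
    have h := Finset.card_product (Finset.univ.filter fun e => DummiesIn U e)
      (Finset.univ : Finset (Fin m))
    rw [Finset.card_fin] at h
    rw [← card_filter_incidence hH, mul_comm m, ← h, ← Finset.card_disjSum]
    refine Finset.card_le_card fun x hx => ?_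
    rcases x with i | ⟨e, d⟩
    · have : IncidencesIn U i.1.2 := by simpa using hx
      exact this i rfl
    · have : DummiesIn U e := by simpa using hx
      exact this d
  have hsplit := Finset.card_filter_add_card_filter_not (s := 𝒞)
    (AvoidsIsolated U)
  -- Each discarded set contains a dummy of an edge with all incidences removed, and disjoint sets
  -- contain different dummies.
  have h2 : (𝒞.filter fun C => ¬ AvoidsIsolated U C).card ≤
      m * (Finset.univ.filter fun e => IncidencesIn U e).card := by
    have h := Finset.card_product (Finset.univ.filter fun e => IncidencesIn U e)
      (Finset.univ : Finset (Fin m))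
    rw [Finset.card_fin] at h
    rw [mul_comm m, ← h]
    have hex : ∀ C ∈ (𝒞.filter fun C => ¬ AvoidsIsolated U C),
        ∃ p : E × Fin m, IncidencesIn U p.1 ∧ .inr p ∈ C := by
      intro C hC
      have := (Finset.mem_filter.1 hC).2
      unfold AvoidsIsolated at this
      push Not at this
      obtain ⟨e, he, d, hd⟩ := this
      exact ⟨(e, d), he, hd⟩
    by_cases hne : (𝒞.filter fun C => ¬ AvoidsIsolated U C).Nonempty
    · have : Nonempty (E × Fin m) := ⟨(hex _ hne.choose_spec).choose⟩
      choose! p hp hpC using hex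
      refine Finset.card_le_card_of_injOn p ?_ ?_
      · intro C hC
        simpa using hp C hC
      · intro C hC D hD hCD
        refine hB.eq_of_mem C (Finset.mem_filter.1 hC).1 D (Finset.mem_filter.1 hD).1
          (.inr (p C)) (hpC C hC) ?_
        rw [hCD]
        exact hpC D hD
    · rw [Finset.not_nonempty_iff_eq_empty.1 hne]
      simp
  have h3 : (mainParts U 𝒞).card =
    (𝒞.filter (AvoidsIsolated U)).card := rfl
  rw [h3]
  nlinarith

/-- The odd sets are disjoint, and each edge has only `m + 2` incidences to share among them. -/
theorem sum_dummyDegree_le (hB : H.IsCriticalBarrier m U 𝒞) (hH : H.IsUniform (m + 2)) :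
    ∑ C ∈ mainParts U 𝒞, dummyDegree U C ≤
      (m + 2) * (Finset.univ.filter fun e => DummiesIn U e).card := by
  rw [← card_filter_incidence hH]
  unfold dummyDegree
  rw [← Finset.card_biUnion]
  · refine Finset.card_le_card fun i hi => ?_
    obtain ⟨C, -, hi⟩ := Finset.mem_biUnion.1 hi
    simpa using (Finset.mem_filter.1 hi).2.2
  · intro C hC D hD hCD
    refine Finset.disjoint_left.2 fun i hi hi' => hCD ?_
    exact hB.eq_of_mem C (Finset.mem_filter.1 hC).1 D (Finset.mem_filter.1 hD).1 _
      (Finset.mem_filter.1 hi).2.1 (Finset.mem_filter.1 hi').2.1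

/-- The odd sets that are not isolated are joined pairwise by removed edges. -/
theorem card_mainParts_le (hB : H.IsCriticalBarrier m U 𝒞) (hm : 0 < m)
    (hH : H.IsCovering 2 (m + 2)) {r : Finset (H.Incidence ⊕ E × Fin m) → V}
    (hr : ∀ C ∈ mainParts U 𝒞, MeetsAt C (r C)) {C : Finset (H.Incidence ⊕ E × Fin m)}
    (hC : C ∈ mainParts U 𝒞) :
    (mainParts U 𝒞).card ≤ (m + 1) * ((Finset.univ.filter fun e =>
      IncidencesIn U e ∧ r C ∈ H.edge e).card + dummyDegree U C) + 1 := by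
  have hne : ∀ e, (H.edge e).Nonempty := fun e =>
    Finset.card_pos.1 (by rw [hH.uniform e]; omega)
  have hC𝒞 := (Finset.mem_filter.1 hC).1
  rw [← Finset.card_erase_add_one hC, add_le_add_iff_right]
  set A := Finset.univ.filter fun e => IncidencesIn U e ∧ r C ∈ H.edge e
  set B := Finset.univ.filter fun e => DummiesIn U e ∧ r C ∈ H.edge e with hBdef
  have hBle : B.card ≤ dummyDegree U C := by
    have hmem : ∀ e ∈ B, ∃ h : r C ∈ H.edge e, .inl ⟨(r C, e), h⟩ ∈ C ∧ DummiesIn U e := by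
      intro e he
      obtain ⟨hT, hre⟩ := (Finset.mem_filter.1 he).2
      exact ⟨hre, hB.inl_mem_of_meetsAt hC𝒞 (hr C hC) hre
        (hB.not_incidencesIn_of_dummiesIn (hne e) hT), hT⟩
    refine Finset.card_le_card_of_surjOn (fun i : H.Incidence => i.1.2) fun e he => ?_
    obtain ⟨h1, h2, h3⟩ := hmem e he
    exact ⟨⟨(r C, e), h1⟩, by simpa using ⟨h2, h3⟩, rfl⟩
  have hinj : Set.InjOn r ((mainParts U 𝒞).erase C) := by
    intro D hD D' hD' hDD
    have hD := Finset.mem_of_mem_erase hD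
    have hD' := Finset.mem_of_mem_erase hD'
    refine hB.eq_of_meetsAt (Finset.mem_filter.1 hD).1 (Finset.mem_filter.1 hD').1
      (hr D hD) ?_
    rw [hDD]
    exact hr D' hD'
  calc ((mainParts U 𝒞).erase C).card
      ≤ ((A ∪ B).biUnion fun e => (H.edge e).erase (r C)).card := by
        refine Finset.card_le_card_of_injOn r ?_ hinj
        intro D hD
        obtain ⟨hDC, hD⟩ := Finset.mem_erase.1 hD
        have hD𝒞 := (Finset.mem_filter.1 hD).1
        have hrr : r D ≠ r C := fun h =>
          hDC (hB.eq_of_meetsAt hD𝒞 hC𝒞 (hr D hD) (h ▸ hr C hC))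
        obtain ⟨e, he⟩ := hH.covers {r D, r C} (Finset.card_pair hrr)
        have h1 : r D ∈ H.edge e := he (by simp)
        have h2 : r C ∈ H.edge e := he (by simp)
        refine Finset.mem_coe.2 (Finset.mem_biUnion.2 ⟨e, ?_, Finset.mem_erase.2 ⟨hrr, h1⟩⟩)
        -- An edge untouched by `U` through both representatives would merge `C` and `D`. So every
        -- other representative lies in a removed edge at `r C`, and each such edge accommodates at
        -- most `m + 1` of them.
        by_contra hAB
        have hST : ¬ IncidencesIn U e ∧ ¬ DummiesIn U e := by
          simpa [A, B, h2] using hAB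
        exact hDC (hB.eq_of_meetsAt hD𝒞 hC𝒞
          (hB.meetsAt_of_mem_edge hm hne hD (hr D hD) h1 h2 hST.1 hST.2) (hr C hC))
    _ ≤ (A ∪ B).card * (m + 1) := by
        refine Finset.card_biUnion_le_card_mul _ _ _ fun e he => ?_
        have hre : r C ∈ H.edge e := by
          rcases Finset.mem_union.1 he with h | h
          · exact (Finset.mem_filter.1 h).2.2
          · exact (Finset.mem_filter.1 h).2.2
        rw [Finset.card_erase_of_mem hre, hH.uniform e]
        rfl
    _ ≤ (m + 1) * (A.card + dummyDegree U C) := by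
        rw [mul_comm]
        exact Nat.mul_le_mul_left _ ((Finset.card_union_le _ _).trans (by omega))

/-- The arithmetic behind the lower and upper bounds for the number of odd sets. -/
theorem counting_bounds {m s t q n : ℕ} (hm : 0 < m) (hq : 2 * s + m * t + 2 ≤ q) (hn : n ≤ q)
    (h3 : 3 * q ≤ (m + 2) * t + 2 * n) (hnq : n * q ≤ (m + 1) * ((m + 2) * s + n) + n) :
    s = 0 ∧ t = 1 ∧ q = m + 2 := by
  -- From `hn` and `h3`, `q ≤ (m + 2) * t`; comparison with `hq` gives the claim.
  have hst : s + 1 ≤ t := by nlinarith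
  obtain ⟨a, rfl⟩ := Nat.exists_eq_add_of_le hst
  have hq' : (m + 2) * s + m + 2 ≤ q := by nlinarith
  obtain ⟨b, rfl⟩ := Nat.exists_eq_add_of_le hq'
  -- From `h3` and `hq`, `2 * n ≥ 6 * (s + 1) + (2 * m - 2) * t`, and `t ≥ s + 1`; positivity of `m`
  -- keeps the coefficient of `t` nonnegative.
  have hn' : (m + 2) * (s + 1) ≤ n := by nlinarith
  have h4 : n * ((m + 2) * s + b) ≤ (m + 1) * (m + 2) * s := by nlinarith
  have h5 : (m + 2) * (s + 1) * ((m + 2) * s + b) ≤ n * ((m + 2) * s + b) :=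
    Nat.mul_le_mul_right _ hn'
  have hs : s = 0 := by
    by_contra hs
    have : 0 < s := Nat.pos_of_ne_zero hs
    have h6 : (m + 2) * (s + 1) * ((m + 2) * s) ≤ (m + 1) * (m + 2) * s :=
      (Nat.mul_le_mul_left _ (Nat.le_add_right _ b)).trans (h5.trans h4)
    have h7 : 0 < (m + 2) * s := by positivity
    have h8 : (m + 2) * (s + 1) ≤ m + 1 := by
      refine Nat.le_of_mul_le_mul_right ?_ h7
      linarith
    nlinarith
  subst hs
  have hb : b = 0 := by
    have h6 : 0 < (m + 2) * (0 + 1) := by positivity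
    by_contra hb
    have : 0 < (m + 2) * (0 + 1) * ((m + 2) * 0 + b) := by positivity
    omega
  subst hb
  have ha : a = 0 := by
    by_contra ha
    have : 0 < a := Nat.pos_of_ne_zero ha
    nlinarith
  subst ha
  simp

/-- A critical barrier with a surplus of two removes a single edge, and it has as many odd sets
as an edge has vertices. -/
theorem card_eq (hB : H.IsCriticalBarrier m U 𝒞) (hm : 0 < m) (hH : H.IsCovering 2 (m + 2))
    (hU : U.card + 2 ≤ 𝒞.card) :
    (Finset.univ.filter fun e => IncidencesIn U e).card = 0 ∧
      (Finset.univ.filter fun e => DummiesIn U e).card = 1 ∧ (mainParts U 𝒞).card = m + 2 := by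
  have hne : ∀ e, (H.edge e).Nonempty := fun e =>
    Finset.card_pos.1 (by rw [hH.uniform e]; omega)
  have hq := hB.le_card_mainParts hH.uniform hU
  have hex : ∀ C ∈ mainParts U 𝒞, ∃ v, MeetsAt C v := fun C hC => hB.exists_meetsAt hm hne hC
  obtain ⟨C₀, hC₀⟩ : (mainParts U 𝒞).Nonempty := Finset.card_pos.1 (by omega)
  have : Nonempty V := ⟨(hex C₀ hC₀).choose⟩
  choose! r hr using hex
  -- Dummy degrees are odd, so outside `𝒮` they are at least three. Sets in `𝒮` have the smallest
  -- dummy degree, and for these `card_mainParts_le` is strongest.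
  let 𝒮 := (mainParts U 𝒞).filter fun C => dummyDegree U C = 1
  have h𝒮 : 𝒮 ⊆ mainParts U 𝒞 := Finset.filter_subset _ _
  refine counting_bounds (n := 𝒮.card) hm hq (Finset.card_le_card h𝒮) ?_ ?_
  · calc 3 * (mainParts U 𝒞).card
        = ∑ C ∈ mainParts U 𝒞, 3 := by rw [Finset.sum_const, smul_eq_mul, mul_comm]
      _ ≤ ∑ C ∈ mainParts U 𝒞, (dummyDegree U C + if dummyDegree U C = 1 then 2 else 0) := by
          refine Finset.sum_le_sum fun C hC => ?_
          obtain ⟨a, ha⟩ := hB.odd_dummyDegree hm hH.uniform hC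
          split_ifs <;> omega
      _ = ∑ C ∈ mainParts U 𝒞, dummyDegree U C + 2 * 𝒮.card := by
          rw [Finset.sum_add_distrib, ← Finset.sum_filter, Finset.sum_const, smul_eq_mul,
            mul_comm 2]
      _ ≤ _ := by
          have := hB.sum_dummyDegree_le hH.uniform
          omega
  · calc 𝒮.card * (mainParts U 𝒞).card
        = ∑ C ∈ 𝒮, (mainParts U 𝒞).card := by rw [Finset.sum_const, smul_eq_mul]
      _ ≤ ∑ C ∈ 𝒮, ((m + 1) * ((Finset.univ.filter fun e =>
            IncidencesIn U e ∧ r C ∈ H.edge e).card + 1) + 1) := by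
          refine Finset.sum_le_sum fun C hC => ?_
          have := hB.card_mainParts_le hm hH hr (h𝒮 hC)
          rwa [(Finset.mem_filter.1 hC).2] at this
      _ = (m + 1) * (∑ C ∈ 𝒮, (Finset.univ.filter fun e =>
            IncidencesIn U e ∧ r C ∈ H.edge e).card + 𝒮.card) + 𝒮.card := by
          simp [Finset.sum_add_distrib, ← Finset.mul_sum]
      _ ≤ _ := by
          have := hB.sum_card_incidencesIn_le hH.uniform hr h𝒮
          gcongr

/-! ### Excluding the extremal case and conclusion -/

/-- The gadget graph of a covering hypergraph with two edges has no critical barrier with a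
surplus of two. -/
theorem false_of_two_le_card (hB : H.IsCriticalBarrier m U 𝒞) (hm : 0 < m)
    (hH : H.IsCovering 2 (m + 2)) (hU : U.card + 2 ≤ 𝒞.card) (hE : 2 ≤ Fintype.card E) :
    False := by
  have hne : ∀ e, (H.edge e).Nonempty := fun e =>
    Finset.card_pos.1 (by rw [hH.uniform e]; omega)
  obtain ⟨hs, ht, hq⟩ := hB.card_eq hm hH hU
  have hS : ∀ e, ¬ IncidencesIn U e := by
    simpa [Finset.filter_eq_empty_iff] using hs
  obtain ⟨e₀, he₀⟩ := Finset.card_eq_one.1 ht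
  have hT : ∀ e, DummiesIn U e ↔ e = e₀ := fun e => by
    have := Finset.ext_iff.1 he₀ e
    simpa using this
  have hex : ∀ C ∈ mainParts U 𝒞, ∃ v, v ∈ H.edge e₀ ∧ MeetsAt C v := by
    intro C hC
    obtain ⟨i, hi⟩ := Finset.card_pos.1 (hB.odd_dummyDegree hm hH.uniform hC).pos
    obtain ⟨hiC, hiT⟩ := (Finset.mem_filter.1 hi).2
    rw [hT] at hiT
    exact ⟨i.1.1, hiT ▸ i.2, i, rfl, hiC⟩
  have : Nonempty V := ⟨(hne e₀).choose⟩
  choose! r hre hr using hex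
  -- There are `m + 2` sets with distinct representatives in `e₀`, so each vertex of `e₀` represents
  -- its own set.
  have hsurj : ∀ v ∈ H.edge e₀, ∃ C ∈ mainParts U 𝒞, r C = v := by
    have := Finset.surj_on_of_inj_on_of_card_le (s := mainParts U 𝒞) (t := H.edge e₀)
      (fun C _ => r C) hre (fun C D hC hD hCD =>
        hB.eq_of_meetsAt (Finset.mem_filter.1 hC).1 (Finset.mem_filter.1 hD).1 (hr C hC)
          (by rw [hCD]; exact hr D hD)) (by rw [hq, hH.uniform e₀])
    intro v hv
    obtain ⟨C, hC, h⟩ := this v hv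
    exact ⟨C, hC, h.symm⟩
  have hsep : ∀ C ∈ mainParts U 𝒞, ∀ v ∈ H.edge e₀, MeetsAt C v → v = r C := by
    intro C hC v hv hCv
    obtain ⟨D, hD, rfl⟩ := hsurj v hv
    rw [hB.eq_of_meetsAt (Finset.mem_filter.1 hC).1 (Finset.mem_filter.1 hD).1 hCv (hr D hD)]
  have hprop : ∀ C ∈ mainParts U 𝒞, ∀ e ≠ e₀, ∀ v ∈ H.edge e, ∀ w ∈ H.edge e,
      MeetsAt C v → MeetsAt C w := fun C hC e he v hv w hw hCv =>
    hB.meetsAt_of_mem_edge hm hne hC hCv hv hw (hS e) (by rwa [hT])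
  have : Nontrivial E := Fintype.one_lt_card_iff_nontrivial.1 hE
  obtain ⟨f, hf⟩ := exists_ne e₀
  -- Every edge other than `e₀` stays within one set. If `f` is inside `e₀`, it joins two vertices
  -- of different sets. Otherwise a vertex `w` of `f` outside `e₀` is covered together with each
  -- vertex of `e₀` by edges other than `e₀`, so all sets meet at `w`.
  by_cases hsub : H.edge f ⊆ H.edge e₀
  · obtain ⟨w₁, hw₁, w₂, hw₂, hww⟩ :=
      Finset.one_lt_card.1 (show 1 < (H.edge f).card by rw [hH.uniform f]; omega)
    obtain ⟨C, hC, rfl⟩ := hsurj w₁ (hsub hw₁)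
    exact hww (hsep C hC w₂ (hsub hw₂) (hprop C hC f hf _ hw₁ _ hw₂ (hr C hC))).symm
  · obtain ⟨w, hwf, hw⟩ := Finset.not_subset.1 hsub
    have hCw : ∀ C ∈ mainParts U 𝒞, MeetsAt C w := by
      intro C hC
      have hwr : w ≠ r C := fun h => hw (h ▸ hre C hC)
      obtain ⟨g, hg⟩ := hH.covers {w, r C} (Finset.card_pair hwr)
      have h1 : w ∈ H.edge g := hg (by simp)
      refine hprop C hC g (fun h => hw (h ▸ h1)) (r C) (hg (by simp)) w h1 (hr C hC)
    obtain ⟨C, hC, D, hD, hCD⟩ :=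
      Finset.one_lt_card.1 (show 1 < (mainParts U 𝒞).card by omega)
    exact hCD (hB.eq_of_meetsAt (Finset.mem_filter.1 hC).1 (Finset.mem_filter.1 hD).1
      (hCw C hC) (hCw D hD))

end IsCriticalBarrier

end

/-- The gadget graph of a covering hypergraph with at least two edges has a perfect matching. -/
theorem exists_perfect_gadget [Fintype V] [Fintype E] {H : MultiHypergraph V E} {k : ℕ}
    (hH : H.IsCovering 2 k) (hE : 2 ≤ Fintype.card E) :
    ∃ M : (H.gadget (k - 2)).Subgraph, M.IsPerfectMatching := by
  classical
  obtain ⟨m, rfl⟩ : ∃ m, k = m + 2 := ⟨k - 2, by have := hH.lt; omega⟩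
  have hm : 0 < m := by have := hH.lt; omega
  rw [Nat.add_sub_cancel]
  by_contra h
  -- Each edge owns `m + 2` incidences and `m` dummies, an even number in all.
  have hN : Even (Fintype.card (H.Incidence ⊕ E × Fin m)) := by
    have := card_filter_gadgetEdge (m := m) hH.uniform fun _ => True
    simp only [Finset.filter_true, Finset.card_univ] at this
    rw [this]
    exact Even.mul_right ⟨m + 1, by ring⟩ _
  obtain ⟨U, 𝒞, hB, hU, h3⟩ := SimpleGraph.exists_minimal_isBarrier hN h
  have hB' : H.IsCriticalBarrier m U 𝒞 := ⟨hB, by convert h3⟩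
  exact hB'.false_of_two_le_card hm hH hU hE

end MultiHypergraph

theorem theorem5 {V E : Type*} [Fintype V] [Fintype E] (k : ℕ) (hk : 4 ≤ k)
    (H : MultiHypergraph V E) (hH : H.IsCovering 2 k) (hE : 2 ≤ Fintype.card E) :
    H.IsQuasiEulerian := by
  obtain ⟨M, hM⟩ := H.exists_perfect_gadget hH hE
  obtain ⟨K, hle, hK, heven⟩ :=
    MultiHypergraph.exists_even_subgraph_of_perfect (by omega) hH.uniform hM
  exact (MultiHypergraph.isQuasiEulerian_of_even hK heven).mono hle
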